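/- All graphs are finite and simple, and connected graphs are nonempty. A longest path of a graph $G$ is a path with the maximum number of edges among all paths of $G$; a single vertex is a path of length $0$. A Gallai set of $G$ is a set of vertices that meets every longest path of $G$, a vertex $v$ is a Gallai vertex if $\{v\}$ is a Gallai set, and $\mathrm{lpt}(G)$ is the minimum size of a Gallai set. A family $\mathcal G$ of graphs is a Gallai family if $\mathrm{lpt}(G)=1$ for every connected $G\in\mathcal G$. For a graph $H$, $\mathrm{Free}(H)$ is the class of graphs with no induced subgraph isomorphic to $H$, and $5P_1$ is the disjoint union of five one-vertex paths. Theorem. Let $G$ be a connected graph with independence number $\alpha(G)\le 4$. Then $G$ has a Gallai vertex, i.e. there is a vertex lying on every longest path of $G$. Equivalently, $\mathrm{Free}(5P_1)$ is a Gallai family. -/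

import Mathlib

universe u w

namespace GallaiPaths

/-- The walk `p` of `G` is a longest path of `G`: it is a path, and no path of `G`
(between any two vertices) has more edges. -/
def IsLongestPath {V : Type u} (G : SimpleGraph V) {a b : V} (p : G.Walk a b) : Prop :=
  p.IsPath ∧ ∀ (c d : V) (q : G.Walk c d), q.IsPath → q.length ≤ p.length

/-- A Gallai set (longest path transversal): every longest path has a vertex in `S`. -/
def IsGallaiSet {V : Type u} (G : SimpleGraph V) (S : Set V) : Prop :=
  ∀ (a b : V) (p : G.Walk a b), IsLongestPath G p → ∃ v ∈ S, v ∈ p.support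

/-- A Gallai vertex: its singleton is a Gallai set. -/
def IsGallaiVertex {V : Type u} (G : SimpleGraph V) (v : V) : Prop :=
  IsGallaiSet G {v}

/-- The Gallai number `lpt(G)`: the minimum size of a Gallai set. For a finite graph the set of
all vertices is a Gallai set, so the minimum is taken over a nonempty set. -/
noncomputable def lpt {V : Type u} (G : SimpleGraph V) : ℕ :=
  sInf {n : ℕ | ∃ S : Finset V, S.card = n ∧ IsGallaiSet G (S : Set V)}

/-- A family (class) of finite graphs. -/
def GraphFamily : Type (u + 1) :=
  ∀ (V : Type u) [Finite V], SimpleGraph V → Prop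

/-- A Gallai family: `lpt(G) = 1` for every connected member `G`. -/
def IsGallaiFamily (𝒢 : GraphFamily.{u}) : Prop :=
  ∀ (V : Type u) [Finite V] (G : SimpleGraph V), 𝒢 V G → G.Connected → lpt G = 1

/-- `Free(H)`: the finite graphs with no induced subgraph isomorphic to `H`. -/
def Free {W : Type w} (H : SimpleGraph W) : GraphFamily.{u} :=
  fun _ _ G => ¬ H.IsIndContained G

/-- The disjoint union `k G` of `k` copies of `G`. -/
def copies (k : ℕ) {W : Type w} (G : SimpleGraph W) : SimpleGraph (Fin k × W) where
  Adj x y := x.1 = y.1 ∧ G.Adj x.2 y.2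
  symm := ⟨fun _ _ h => ⟨h.1.symm, h.2.symm⟩⟩
  loopless := ⟨fun _ h => G.irrefl h.2⟩

end GallaiPaths

/-!
Paths are handled as lists of vertices. Let `P` be a longest path that misses a vertex, and `D` a
component of `G - P`; an attachment vertex of `D` is a vertex of `P` with a neighbour in `D`. As
in the proof of the Chvátal–Erdős theorem, a vertex of `D`, the first vertex of `P` and the
successors on `P` of the attachment vertices form an independent set. As the independence number
is at most `4`, `D` has at most two attachment vertices (`IsCompOff.attach_eq_or_eq`). If it has
two, `D` is a clique (`IsCompOff.adj_of_two`), and in any case `D` has no three independent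
vertices (`IsCompOff.length_le_two`).

Suppose that some `D` has two attachment vertices, `a` and then `b`. Then `a` lies on every
longest path (`IsCompOff.mem_of_two`). Indeed, let `Q` be a longest path that avoids `a`, and `E`
the component of `a` off `Q`. Counting independent vertices shows that `E` has two attachment
vertices, hence is a clique; they are a neighbour `x` of `a` in `D` and a vertex `y` of `P` after
`a`. So `P` up to `a` lies in `E`, and `Q` up to `x`, in the suitable direction, lies in `D`.
Exchanging these two segments along the edge `a x` gives two paths with more vertices in total
than `P` and `Q`, which is impossible.

Suppose that every component off every longest path has a single attachment vertex. Let `a` be the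
one of `D`, let `Q` be a longest path that avoids `a`, and let `y` be the attachment vertex of the
component `E` of `a` off `Q`. Then `y` is next to `a` on `P` (`IsCompOff.eq_neighbor_of_unique`).
If a longest path `R` avoids `y`, its component `F` of `y` contains `E`, so its attachment vertex
`w` is next to `a` on `P` too. But `w` is not `y`, and the other neighbour of `a` on `P` lies in
`E`, whereas `w` lies on `Q`. So one of `a` and `y` is a Gallai vertex.
-/

namespace GallaiPaths

/-! ### Paths as vertex lists, components off a path, attachment vertices -/

variable {V : Type u} {G : SimpleGraph V}

/-- A path of `G`, encoded as the list of its vertices. The empty list is allowed; it never is a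
longest path of a graph with a vertex. -/
def IsPathList (G : SimpleGraph V) (l : List V) : Prop :=
  l.IsChain G.Adj ∧ l.Nodup

/-- A longest path of `G`, encoded as the list of its vertices. -/
def IsLongest (G : SimpleGraph V) (l : List V) : Prop :=
  IsPathList G l ∧ ∀ l', IsPathList G l' → l'.length ≤ l.length

/-- `D` is the vertex set of a connected component of `G` minus the vertices of `l`. Connectedness
is expressed by paths, in list form, that stay inside `D`. -/
structure IsCompOff (G : SimpleGraph V) (l : List V) (D : Set V) : Prop where
  nonempty : D.Nonempty
  notMem : ∀ d ∈ D, d ∉ l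
  closed : ∀ d ∈ D, ∀ v, G.Adj d v → v ∉ l → v ∈ D
  conn : ∀ u ∈ D, ∀ v ∈ D, ∃ q : List V, IsPathList G q ∧ q.head? = some u ∧
    q.getLast? = some v ∧ ∀ w ∈ q, w ∈ D

/-- `a` is a vertex of the list `l` with a neighbour in `D`. -/
def IsAttach (G : SimpleGraph V) (l : List V) (D : Set V) (a : V) : Prop :=
  a ∈ l ∧ ∃ d ∈ D, G.Adj d a

/-- The vertices of `l` are distinct and pairwise nonadjacent. -/
def IsIndepList (G : SimpleGraph V) (l : List V) : Prop :=
  l.Pairwise fun u v => u ≠ v ∧ ¬ G.Adj u v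

/-- The first vertex of `l`, if there is one, is adjacent to `a`. The same condition on the last
vertex of `l` is expressed by `StartAdj G a l.reverse`. -/
def StartAdj (G : SimpleGraph V) (a : V) (l : List V) : Prop :=
  ∀ v ∈ l.head?, G.Adj a v

theorem startAdj_cons {a v : V} {l : List V} : StartAdj G a (v :: l) ↔ G.Adj a v := by
  simp [StartAdj]

theorem startAdj_nil {a : V} : StartAdj G a [] := by
  simp [StartAdj]

theorem startAdj_append {a : V} {l₁ l₂ : List V} (h : l₁ ≠ []) :
    StartAdj G a (l₁ ++ l₂) ↔ StartAdj G a l₁ := by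
  cases l₁ <;> simp_all [StartAdj]

theorem IsPathList.reverse {l : List V} (h : IsPathList G l) : IsPathList G l.reverse := by
  refine ⟨List.isChain_reverse.2 ?_, List.nodup_reverse.2 h.2⟩
  exact h.1.imp fun _ _ => G.adj_symm

theorem isPathList_reverse {l : List V} : IsPathList G l.reverse ↔ IsPathList G l :=
  ⟨fun h => by simpa using h.reverse, fun h => h.reverse⟩

theorem IsLongest.reverse {l : List V} (h : IsLongest G l) : IsLongest G l.reverse :=
  ⟨h.1.reverse, by simpa using h.2⟩

theorem isPathList_nil : IsPathList G [] := ⟨.nil, .nil⟩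

theorem isPathList_cons {a : V} {l : List V} : IsPathList G (a :: l) ↔
    IsPathList G l ∧ a ∉ l ∧ StartAdj G a l := by
  unfold IsPathList StartAdj
  rw [List.isChain_cons, List.nodup_cons]
  tauto

theorem isPathList_append_cons {l₁ l₂ : List V} {b : V} : IsPathList G (l₁ ++ b :: l₂) ↔
    IsPathList G l₁ ∧ IsPathList G (b :: l₂) ∧ (∀ u ∈ l₁, u ∉ b :: l₂) ∧
      StartAdj G b l₁.reverse := by
  have : StartAdj G b l₁.reverse ↔ ∀ u ∈ l₁.getLast?, G.Adj u b := by
    simp [StartAdj, G.adj_comm]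
  unfold IsPathList
  rw [List.isChain_append, List.nodup_append, this]
  simp only [List.head?_cons, Option.mem_some_iff, forall_eq']
  grind

variable {l : List V} {D : Set V}

theorem IsCompOff.reverse (h : IsCompOff G l D) : IsCompOff G l.reverse D :=
  ⟨h.nonempty, by simpa using h.notMem, by simpa using h.closed, h.conn⟩

theorem IsAttach.reverse {a : V} (h : IsAttach G l D a) : IsAttach G l.reverse D a :=
  ⟨by simpa using h.1, h.2⟩

/-- Some neighbour of an attachment vertex `a` is joined to some neighbour of an attachment vertex
`b` by a path through the component. -/
theorem IsCompOff.exists_path (h : IsCompOff G l D) {a b : V} (ha : IsAttach G l D a)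
    (hb : IsAttach G l D b) : ∃ q : List V, IsPathList G q ∧ q ≠ [] ∧ StartAdj G a q ∧
      StartAdj G b q.reverse ∧ ∀ w ∈ q, w ∈ D := by
  obtain ⟨-, d, hd, hda⟩ := ha
  obtain ⟨-, e, he, heb⟩ := hb
  obtain ⟨q, hq, h1, h2, h3⟩ := h.conn d hd e he
  exact ⟨q, hq, by grind, by simpa [StartAdj, h1] using hda.symm,
    by simpa [StartAdj, h2] using heb.symm, h3⟩

/-- Otherwise the path could be prolonged at its first vertex. -/
theorem IsCompOff.not_adj_head (h : IsCompOff G l D) (hl : IsLongest G l) {s d : V}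
    (hs : s ∈ l.head?) (hd : d ∈ D) : ¬ G.Adj d s := by
  intro hds
  have := hl.2 (d :: l) (isPathList_cons.2
    ⟨hl.1, h.notMem d hd, by simpa [StartAdj, Option.mem_def.1 hs]⟩)
  simp at this

theorem IsCompOff.not_adj_getLast (h : IsCompOff G l D) (hl : IsLongest G l) {s d : V}
    (hs : s ∈ l.getLast?) (hd : d ∈ D) : ¬ G.Adj d s :=
  h.reverse.not_adj_head hl.reverse (by simpa using hs) hd

/-! ### Neighbours of attachment vertices on a longest path -/

section Split

variable {A B C : List V} {a b : V}

theorem IsAttach.left_ne_nil (h : IsCompOff G l D) (hl : IsLongest G l) (hP : l = A ++ a :: B)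
    (ha : IsAttach G l D a) : A ≠ [] := by
  subst hP
  rintro rfl
  obtain ⟨-, d, hd, hda⟩ := ha
  exact h.not_adj_head hl (by simp) hd hda

theorem IsAttach.right_ne_nil (h : IsCompOff G l D) (hl : IsLongest G l) (hP : l = A ++ a :: B)
    (ha : IsAttach G l D a) : B ≠ [] := by
  subst hP
  rintro rfl
  obtain ⟨-, d, hd, hda⟩ := ha
  exact h.not_adj_getLast hl (by simp) hd hda

/-- Otherwise a path through `D` could be inserted between `a` and its successor `c`. -/
theorem IsCompOff.not_adj_succ (h : IsCompOff G l D)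
    (hl : IsLongest G l) (hP : l = A ++ a :: B) (ha : IsAttach G l D a) {c d : V}
    (hc : c ∈ B.head?) (hd : d ∈ D) : ¬ G.Adj d c := by
  subst hP
  intro hdc
  obtain ⟨B, rfl⟩ : ∃ B', B = c :: B' := List.head?_eq_some_iff.1 hc
  obtain ⟨q, hq, h0, h1, h2, h3⟩ := h.exists_path ha (b := c) ⟨by simp, d, hd, hdc⟩
  have hn := h.notMem
  have hp := hl.1
  have hlen := hl.2 (A ++ a :: (q ++ c :: B)) (by
    simp only [isPathList_append_cons, isPathList_cons, startAdj_append h0] at hp ⊢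
    grind)
  have := List.length_pos_iff.2 h0
  simp only [List.length_append, List.length_cons] at hlen
  omega

/-- Otherwise the path could be rerouted through the edge `s c`, so as to end at `a`, and then be
prolonged into `D`. -/
theorem IsCompOff.not_adj_head_succ (h : IsCompOff G l D)
    (hl : IsLongest G l) (hP : l = A ++ a :: B) (ha : IsAttach G l D a) {s c : V}
    (hs : s ∈ A.head?) (hc : c ∈ B.head?) : ¬ G.Adj s c := by
  subst hP
  intro hsc
  obtain ⟨B, rfl⟩ : ∃ B', B = c :: B' := List.head?_eq_some_iff.1 hc
  obtain ⟨A, rfl⟩ : ∃ A', A = s :: A' := List.head?_eq_some_iff.1 hs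
  obtain ⟨-, d, hd, hda⟩ := ha
  have hn := h.notMem
  have hp := hl.1
  have hlen := hl.2 (d :: a :: ((s :: A).reverse ++ c :: B)) (by
    have h0 : (s :: A).reverse ≠ [] := by simp
    simp only [isPathList_append_cons, isPathList_cons (a := a), isPathList_cons (a := c),
      isPathList_cons (a := d), startAdj_append h0, isPathList_reverse, List.reverse_reverse,
      startAdj_cons, hsc.symm] at hp ⊢
    grind)
  simp only [List.length_append, List.length_cons, List.length_reverse] at hlen
  omega

/-- The successors `c` and `e` of two attachment vertices `a` and `b` are not adjacent: otherwise
one could go from `a` through `D` to `b`, back along the path to `c`, and on from `e`. -/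
theorem IsCompOff.not_adj_succ_succ (h : IsCompOff G l D)
    (hl : IsLongest G l) (hP : l = A ++ a :: (B ++ b :: C)) (ha : IsAttach G l D a)
    (hb : IsAttach G l D b) {c e : V}
    (hc : c ∈ B.head?) (he : e ∈ C.head?) : ¬ G.Adj c e := by
  subst hP
  intro hce
  obtain ⟨B, rfl⟩ : ∃ B', B = c :: B' := List.head?_eq_some_iff.1 hc
  obtain ⟨C, rfl⟩ : ∃ C', C = e :: C' := List.head?_eq_some_iff.1 he
  obtain ⟨q, hq, h0, h1, h2, h3⟩ := h.exists_path ha hb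
  have hn := h.notMem
  have hp := hl.1
  have hlen := hl.2 (A ++ a :: (q ++ b :: ((c :: B).reverse ++ e :: C))) (by
    have h0' : (c :: B).reverse ≠ [] := by simp
    have h0'' : (c :: B) ≠ [] := by simp
    simp only [isPathList_append_cons, isPathList_cons (a := a), isPathList_cons (a := b),
      isPathList_cons (a := e), startAdj_append h0, startAdj_append h0', startAdj_append h0'',
      isPathList_reverse, List.reverse_reverse, startAdj_cons, hce.symm] at hp ⊢
    grind)
  have := List.length_pos_iff.2 h0
  simp only [List.length_append, List.length_cons, List.length_reverse] at hlen
  omega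

end Split

/-! ### Independent sets given by attachment vertices -/

section Independence

variable {A B C E : List V} {a b c : V}

theorem IsCompOff.indep_one (h : IsCompOff G l D) (hl : IsLongest G l) (hP : l = A ++ a :: B)
    (ha : IsAttach G l D a) {x s c : V} (hx : x ∈ D) (hs : s ∈ A.head?) (hc : c ∈ B.head?) :
    IsIndepList G [x, s, c] := by
  have h1 := h.not_adj_head hl (s := s) (by simp_all) hx
  have h2 := h.not_adj_succ hl hP ha hc hx
  have h3 := h.not_adj_head_succ hl hP ha hs hc
  have h4 := h.notMem x hx
  have h5 := hl.1.2
  have hs' := List.mem_of_mem_head? hs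
  have hc' := List.mem_of_mem_head? hc
  subst hP
  rw [List.nodup_append] at h5
  simp only [IsIndepList, List.pairwise_cons, List.mem_cons, List.Pairwise.nil]
  grind

theorem IsCompOff.indep_two (h : IsCompOff G l D) (hl : IsLongest G l)
    (hP : l = A ++ a :: (B ++ b :: C)) (ha : IsAttach G l D a) (hb : IsAttach G l D b)
    {x s c e : V} (hx : x ∈ D) (hs : s ∈ A.head?) (hc : c ∈ B.head?) (he : e ∈ C.head?) :
    IsIndepList G [x, s, c, e] := by
  have hP' : l = (A ++ a :: B) ++ b :: C := by simp [hP]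
  have h1 := h.indep_one hl hP ha hx hs (c := c) (by simp_all)
  have h2 := h.indep_one hl hP' hb hx (s := s) (by simp_all) he
  have h3 := h.not_adj_succ_succ hl hP ha hb hc he
  have h5 := hl.1.2
  have hc' := List.mem_of_mem_head? hc
  have he' := List.mem_of_mem_head? he
  rw [hP', List.nodup_append] at h5
  simp only [IsIndepList, List.pairwise_cons, List.mem_cons, List.Pairwise.nil] at h1 h2 ⊢
  grind

theorem IsCompOff.mid_ne_nil (h : IsCompOff G l D) (hl : IsLongest G l)
    (hP : l = A ++ a :: (B ++ b :: C)) (ha : IsAttach G l D a) (hb : IsAttach G l D b) :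
    B ≠ [] := by
  rintro rfl
  obtain ⟨-, d, hd, hdb⟩ := hb
  exact h.not_adj_succ hl hP ha (by simp) hd hdb

/-- With independence number at most `4`, a component off a longest path does not attach to three
vertices of the path: a vertex of the component, the first vertex of the path and the three
successors would be independent. -/
theorem IsCompOff.not_three (hα : ∀ l, IsIndepList G l → l.length ≤ 4) (h : IsCompOff G l D)
    (hl : IsLongest G l) (hP : l = A ++ a :: (B ++ b :: (C ++ c :: E))) (ha : IsAttach G l D a)
    (hb : IsAttach G l D b) (hc : IsAttach G l D c) : False := by
  have hP₁ : l = A ++ a :: ((B ++ b :: C) ++ c :: E) := by simp [hP]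
  have hP₂ : l = (A ++ a :: B) ++ b :: (C ++ c :: E) := by simp [hP]
  have hP₃ : l = ((A ++ a :: B) ++ b :: C) ++ c :: E := by simp [hP]
  obtain ⟨s, A', rfl⟩ := List.exists_cons_of_ne_nil (ha.left_ne_nil h hl hP)
  obtain ⟨v, C', rfl⟩ := List.exists_cons_of_ne_nil (h.mid_ne_nil hl hP₂ hb hc)
  obtain ⟨u, B', rfl⟩ := List.exists_cons_of_ne_nil (h.mid_ne_nil hl hP ha hb)
  obtain ⟨w, E', rfl⟩ := List.exists_cons_of_ne_nil (hc.right_ne_nil h hl hP₃)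
  obtain ⟨x, hx⟩ := h.nonempty
  have h1 := h.indep_two hl hP ha hb hx (by simp; rfl) (by simp; rfl) (by simp; rfl)
  have h2 := h.indep_two hl hP₁ ha hc hx (by simp; rfl) (by simp; rfl) (by simp; rfl)
  have h3 := h.indep_two hl hP₂ hb hc hx (by simp; rfl) (by simp; rfl) (by simp; rfl)
  have := hα [x, s, u, v, w] (by
    simp only [IsIndepList, List.pairwise_cons, List.mem_cons, List.Pairwise.nil] at h1 h2 h3 ⊢
    grind)
  simp at this

theorem exists_split_of_ne (hab : a ≠ b) (ha : a ∈ l) (hb : b ∈ l) :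
    ∃ A B C, l = A ++ a :: (B ++ b :: C) ∨ l = A ++ b :: (B ++ a :: C) := by
  obtain ⟨A, B, rfl⟩ := List.append_of_mem ha
  simp only [List.mem_append, List.mem_cons, hab.symm, false_or] at hb
  rcases hb with hb | hb <;> obtain ⟨X, Y, rfl⟩ := List.append_of_mem hb
  · exact ⟨X, Y, B, .inr (by simp)⟩
  · exact ⟨A, X, Y, .inl rfl⟩

theorem IsCompOff.attach_eq_or_eq (hα : ∀ l, IsIndepList G l → l.length ≤ 4)
    (h : IsCompOff G l D) (hl : IsLongest G l) (ha : IsAttach G l D a) (hb : IsAttach G l D b)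
    (hab : a ≠ b) (hc : IsAttach G l D c) : c = a ∨ c = b := by
  have key : ∀ {a b : V} {A B C : List V}, l = A ++ a :: (B ++ b :: C) → IsAttach G l D a →
      IsAttach G l D b → c = a ∨ c = b := by
    intro a b A B C hP ha hb
    by_contra! hne
    have hc' := hc.1
    simp only [hP, List.mem_append, List.mem_cons, hne.1, hne.2, false_or] at hc'
    rcases hc' with hc' | hc' | hc' <;> obtain ⟨X, Y, rfl⟩ := List.append_of_mem hc'
    · exact h.not_three hα hl (by simp [hP]; rfl) hc ha hb
    · exact h.not_three hα hl (by simp [hP]; rfl) ha hc hb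
    · exact h.not_three hα hl (by simp [hP]; rfl) ha hb hc
  obtain ⟨A, B, C, hP | hP⟩ := exists_split_of_ne hab ha.1 hb.1
  · exact key hP ha hb
  · exact (key hP hb ha).symm

end Independence

/-! ### Connectedness and the independence number of components off a longest path -/

section Connected

theorem forall_mem_of_isChain_cons {S : Set V} {l : List V} :
    ∀ {a : V}, (a :: l).IsChain G.Adj → a ∈ S → (∀ u ∈ S, ∀ v ∈ l, G.Adj u v → v ∈ S) →
      ∀ v ∈ l, v ∈ S := by
  induction l with
  | nil => simp
  | cons b l ih =>
    intro a hl ha hS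
    rw [List.isChain_cons_cons] at hl
    have hb := hS a ha b (by simp) hl.1
    have := ih hl.2 hb fun u hu v hv => hS u hu v (by simp [hv])
    simpa [hb] using this

/-- A path with a vertex in a component off `l` and without attachment vertices stays in the
component. -/
theorem IsCompOff.forall_mem (h : IsCompOff G l D) {m : List V} (hm : IsPathList G m)
    (hD : ∀ v ∈ m, ¬ IsAttach G l D v) {a : V} (ham : a ∈ m) (haD : a ∈ D) : ∀ v ∈ m, v ∈ D := by
  have hS : ∀ u ∈ D, ∀ v ∈ m, G.Adj u v → v ∈ D := fun u hu v hv huv =>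
    h.closed u hu v huv fun hvl => hD v hv ⟨hvl, u, hu, huv⟩
  obtain ⟨A, B, rfl⟩ := List.append_of_mem ham
  have hB := forall_mem_of_isChain_cons (List.isChain_append.1 hm.1).2.1 haD
    fun u hu v hv => hS u hu v (by simp [hv])
  have hm' := hm.reverse.1
  rw [List.reverse_append, List.reverse_cons, List.append_assoc] at hm'
  have hA := forall_mem_of_isChain_cons (List.isChain_append.1 hm').2.1 haD
    fun u hu v hv => hS u hu v (by simp at hv; simp [hv])
  intro v hv
  simp only [List.mem_append, List.mem_cons] at hv
  rcases hv with hv | rfl | hv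
  · exact hA v (by simpa using hv)
  · exact haD
  · exact hB v hv

theorem exists_isCompOff {a : V} (ha : a ∉ l) : ∃ D, IsCompOff G l D ∧ a ∈ D := by
  classical
  let H := G.induce {v | v ∉ l}
  refine ⟨{v | ∃ h : v ∉ l, H.Reachable ⟨a, ha⟩ ⟨v, h⟩}, ⟨⟨a, ha, .refl _⟩, ?_, ?_, ?_⟩,
    ha, .refl _⟩
  · rintro d ⟨h, -⟩
    exact h
  · rintro d ⟨h, hd⟩ v hdv hv
    exact ⟨hv, hd.trans (SimpleGraph.Adj.reachable (by simpa [H] using hdv))⟩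
  · rintro u ⟨hu, hau⟩ v ⟨hv, hav⟩
    obtain ⟨p, hp⟩ := (hau.symm.trans hav).exists_isPath
    refine ⟨p.support.map Subtype.val, ⟨?_, hp.support_nodup.map Subtype.val_injective⟩, ?_, ?_, ?_⟩
    · rw [List.isChain_map]
      exact p.isChain_adj_support.imp fun x y h => by simpa [H] using h
    · rw [List.head?_map, List.head?_eq_some_head p.support_ne_nil]
      simp
    · rw [List.getLast?_map, List.getLast?_eq_some_getLast p.support_ne_nil]
      simp
    · intro w hw
      obtain ⟨⟨w, h⟩, hw', rfl⟩ := List.mem_map.1 hw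
      exact ⟨h, hau.trans ⟨p.takeUntil _ hw'⟩⟩

theorem IsCompOff.exists_isAttach (hG : G.Preconnected) (h : IsCompOff G l D)
    (hl : IsLongest G l) : ∃ a, IsAttach G l D a := by
  obtain ⟨d, hd⟩ := h.nonempty
  have := hl.2 [d] (isPathList_cons.2 ⟨isPathList_nil, by simp, startAdj_nil⟩)
  obtain ⟨a, ha⟩ := List.exists_mem_of_length_pos this
  by_contra! hno
  have key : ∀ {u v : V} (p : G.Walk u v), u ∈ D → v ∈ D := by
    intro u v p
    induction p with
    | nil => exact id
    | cons huw _ ih =>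
      exact fun hu => ih (h.closed _ hu _ huw fun hw => hno _ ⟨hw, _, hu, huw⟩)
  obtain ⟨p⟩ := hG d a
  exact h.notMem a (key p hd) ha

/-- A path through `a` contains a path that ends at `a` and has at least half as many vertices. -/
theorem IsPathList.exists_half (h : IsPathList G l) {a : V} (ha : a ∈ l) :
    ∃ m, IsPathList G (a :: m) ∧ (∀ v ∈ m, v ∈ l) ∧ l.length ≤ 2 * m.length + 1 := by
  obtain ⟨A, B, rfl⟩ := List.append_of_mem ha
  by_cases hAB : A.length ≤ B.length
  · exact ⟨B, (isPathList_append_cons.1 h).2.1, by simp +contextual, by simp; omega⟩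
  · have h' := h.reverse
    rw [List.reverse_append, List.reverse_cons, List.append_assoc] at h'
    exact ⟨A.reverse, (isPathList_append_cons.1 h').2.1, by simp +contextual, by simp; omega⟩

theorem exists_first_mem {S : Set V} {q : List V} (hq : ∃ v ∈ q, v ∈ S) :
    ∃ A b B, q = A ++ b :: B ∧ b ∈ S ∧ ∀ v ∈ A, v ∉ S := by
  induction q with
  | nil => simp at hq
  | cons a q ih =>
    by_cases ha : a ∈ S
    · exact ⟨[], a, q, rfl, ha, by simp⟩
    · obtain ⟨A, b, B, rfl, hb, hA⟩ := ih (by simpa [ha] using hq)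
      exact ⟨a :: A, b, B, rfl, hb, by simpa [ha] using hA⟩

/-- In a connected graph any two longest paths meet. Otherwise a path that joins them, together
with the longer halves of both, would be longer. -/
theorem IsLongest.exists_mem_mem (hG : G.Preconnected) {P Q : List V} (hP : IsLongest G P)
    (hQ : IsLongest G Q) (hne : P ≠ []) : ∃ v ∈ P, v ∈ Q := by
  by_contra! hPQ
  obtain ⟨p, hp⟩ := List.exists_mem_of_ne_nil P hne
  obtain ⟨D, hD, hpD⟩ := exists_isCompOff (G := G) (hPQ p hp)
  obtain ⟨y, hy, d, hd, hdy⟩ := hD.exists_isAttach hG hQ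
  obtain ⟨q, hq, hq₁, hq₂, hqD⟩ := hD.conn d hd p hpD
  obtain ⟨A, b, B, rfl, hb, hA⟩ := exists_first_mem (S := {v | v ∈ P}) (q := q)
    ⟨p, List.mem_of_getLast? hq₂, hp⟩
  obtain ⟨m, hm, hmP, hmlen⟩ := hP.1.exists_half hb
  obtain ⟨n, hn, hnQ, hnlen⟩ := hQ.1.exists_half hy
  have hd' := hD.notMem
  have hlen := hP.2 (n.reverse ++ y :: (A ++ b :: m)) (by
    have hyA : StartAdj G y (A ++ b :: m) := by
      cases A <;> simp_all [StartAdj, G.adj_comm]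
    have hdisj : ∀ u ∈ m, u ∉ A := fun u hu hu' => hA u hu' (hmP u hu)
    simp only [isPathList_append_cons, isPathList_cons (a := y), isPathList_reverse,
      List.reverse_reverse] at hq hn hm ⊢
    simp only [Set.mem_ofPred_eq, List.mem_append, List.mem_cons, List.mem_reverse] at *
    refine ⟨hn.1, ⟨⟨hq.1, hm, ?_, hq.2.2.2⟩, ?_, hyA⟩, ?_, hn.2.2⟩
    · grind
    · grind
    · grind)
  simp at hlen
  have := hQ.2 P hP.1
  omega

/-- A component off a longest path has independence number at most `2`: the first vertex of the path
and the successor of an attachment vertex extend any independent set of the component. -/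
theorem IsCompOff.length_le_two (hα : ∀ l, IsIndepList G l → l.length ≤ 4)
    (hG : G.Preconnected) (h : IsCompOff G l D) (hl : IsLongest G l) {m : List V}
    (hm : IsIndepList G m) (hmD : ∀ v ∈ m, v ∈ D) : m.length ≤ 2 := by
  obtain ⟨a, ha⟩ := h.exists_isAttach hG hl
  obtain ⟨A, B, hP⟩ := List.append_of_mem ha.1
  obtain ⟨s, A', rfl⟩ := List.exists_cons_of_ne_nil (ha.left_ne_nil h hl hP)
  obtain ⟨c, B', rfl⟩ := List.exists_cons_of_ne_nil (ha.right_ne_nil h hl hP)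
  have key := fun x hx => h.indep_one hl hP ha (x := x) hx (by simp; rfl) (by simp; rfl)
  have := hα (m ++ [s, c]) (by
    obtain ⟨x, hx⟩ := h.nonempty
    refine List.pairwise_append.2 ⟨hm, (List.pairwise_cons.1 (key x hx)).2, fun u hu v hv => ?_⟩
    exact (List.pairwise_cons.1 (key u (hmD u hu))).1 v hv)
  simp at this
  omega

/-- A component with two attachment vertices is a clique: the first vertex of the path and the
successors of the attachment vertices extend any independent set of the component. -/
theorem IsCompOff.adj_of_two (hα : ∀ l, IsIndepList G l → l.length ≤ 4) (h : IsCompOff G l D)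
    (hl : IsLongest G l) {a b : V} (ha : IsAttach G l D a) (hb : IsAttach G l D b) (hab : a ≠ b)
    {u v : V} (hu : u ∈ D) (hv : v ∈ D) (huv : u ≠ v) : G.Adj u v := by
  have key : ∀ {a b : V} {A B C : List V}, l = A ++ a :: (B ++ b :: C) → IsAttach G l D a →
      IsAttach G l D b → G.Adj u v := by
    intro a b A B C hP ha hb
    obtain ⟨s, A', rfl⟩ := List.exists_cons_of_ne_nil (ha.left_ne_nil h hl hP)
    obtain ⟨c, B', rfl⟩ := List.exists_cons_of_ne_nil (h.mid_ne_nil hl hP ha hb)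
    obtain ⟨e, C', rfl⟩ := List.exists_cons_of_ne_nil (hb.right_ne_nil h hl (B := C)
      (A := (s :: A') ++ a :: (c :: B')) (by simp [hP]))
    have key := fun x hx => h.indep_two hl hP ha hb (x := x) hx (by simp; rfl) (by simp; rfl)
      (by simp; rfl)
    by_contra hnadj
    have := hα (u :: v :: [s, c, e]) (by
      refine List.pairwise_cons.2 ⟨?_, key v hv⟩
      simp only [List.forall_mem_cons (a := v)]
      exact ⟨⟨huv, hnadj⟩, (List.pairwise_cons.1 (key u hu)).1⟩)
    simp at this
  obtain ⟨A, B, C, hP | hP⟩ := exists_split_of_ne hab ha.1 hb.1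
  · exact key hP ha hb
  · exact key hP hb ha

/-- A component off `P` with an attachment vertex in a component `E` off `Q` lies in `E` unless it
contains an attachment vertex of `E`. -/
theorem IsCompOff.subset {P Q : List V} {D E : Set V} (hD : IsCompOff G P D)
    (hE : IsCompOff G Q E) {a : V} (ha : IsAttach G P D a) (haE : a ∈ E)
    (hDE : ∀ z ∈ D, ¬ IsAttach G Q E z) : D ⊆ E := by
  obtain ⟨-, d, hd, hda⟩ := ha
  have hdE : d ∈ E := hE.closed a haE d hda.symm fun h => hDE d hd ⟨h, a, haE, hda.symm⟩
  intro z hz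
  obtain ⟨q, hq, h1, h2, hqD⟩ := hD.conn d hd z hz
  exact hE.forall_mem hq (fun v hv => hDE v (hqD v hv)) (List.mem_of_mem_head? h1) hdE z
    (List.mem_of_getLast? h2)

/-- A longest path `P` that meets a component off another longest path `Q` also contains an
attachment vertex of that component. -/
theorem IsCompOff.exists_isAttach_mem (hG : G.Preconnected) {P Q : List V} {E : Set V}
    (hE : IsCompOff G Q E) (hP : IsLongest G P) (hQ : IsLongest G Q) {a : V} (haP : a ∈ P)
    (haE : a ∈ E) : ∃ y ∈ P, IsAttach G Q E y := by
  by_contra! hno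
  have h := hE.forall_mem hP.1 hno haP haE
  obtain ⟨v, hvP, hvQ⟩ := hP.exists_mem_mem hG hQ (List.ne_nil_of_mem haP)
  exact hE.notMem v (h v hvP) hvQ

end Connected

/-! ### Vertices on every longest path -/

section Transversal

variable {P Q : List V} {D E : Set V} {S₀ S₁ S₂ : List V} {a b x y : V}

theorem IsIndepList.sublist {m n : List V} (h : IsIndepList G n) (hmn : m.Sublist n) :
    IsIndepList G m :=
  List.Pairwise.sublist hmn h

/-- Let `P` have a component `D` attached to both `a` and `b`. A component `E` that contains `a`,
off another longest path `Q`, has at least two attachment vertices. With a single one, `y`, all of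
`D` would lie in `E`, and so would three independent vertices: one in `D` and two that are ends of
`P` or `P`-neighbours of `a` and `b`. -/
theorem IsCompOff.exists_ne_isAttach_of_two (hα : ∀ l, IsIndepList G l → l.length ≤ 4)
    (hG : G.Preconnected) (hP : IsLongest G P) (hS : P = S₀ ++ a :: (S₁ ++ b :: S₂))
    (hD : IsCompOff G P D) (ha : IsAttach G P D a) (hb : IsAttach G P D b) (hQ : IsLongest G Q)
    (hE : IsCompOff G Q E) (haE : a ∈ E) (hyP : y ∈ P) (hy : IsAttach G Q E y) :
    ∃ z, IsAttach G Q E z ∧ z ≠ y := by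
  by_contra! huniq
  have hDE := hD.subset hE ha haE fun z hz hz' => hD.notMem z hz (huniq z hz' ▸ hyP)
  have hyE : y ∉ E := fun h => hE.notMem y h hy.1
  obtain ⟨x, hx⟩ := hD.nonempty
  have hbE : b ≠ y → b ∈ E := fun hby => by
    obtain ⟨-, d, hd, hdb⟩ := hb
    exact hE.closed d (hDE hd) b hdb fun h => hby (huniq b ⟨h, d, hDE hd, hdb⟩)
  have hseg : ∀ m, IsPathList G m → y ∉ m → ∀ v ∈ m, v ∈ E → ∀ w ∈ m, w ∈ E :=
    fun m hm hym v hv hvE => hE.forall_mem hm (fun u hu hu' => hym (huniq u hu' ▸ hu)) hv hvE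
  have hind : ∀ {u v w : V}, IsIndepList G [u, v, w] → u ∈ E → v ∈ E → w ∈ E → False := by
    intro u v w h hu hv hw
    have := hE.length_le_two hα hG hQ h (by simp [hu, hv, hw])
    simp at this
  have hrev : P.reverse = S₂.reverse ++ b :: (S₁.reverse ++ a :: S₀.reverse) := by simp [hS]
  have h₀ := ha.left_ne_nil hD hP hS
  have h₁ := hD.mid_ne_nil hP hS ha hb
  have h₂ := hb.right_ne_nil hD hP (A := S₀ ++ a :: S₁) (B := S₂) (by simp [hS])
  have hnd := hP.1.2
  have hpath := hP.1
  have hI := hD.indep_two hP hS ha hb hx (List.head_mem_head? h₀)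
    (List.head_mem_head? h₁) (List.head_mem_head? h₂)
  have hJ := hD.reverse.indep_two hP.reverse hrev hb.reverse ha.reverse hx
    (by rw [List.head?_reverse]; exact List.getLast_mem_getLast? h₂)
    (by rw [List.head?_reverse]; exact List.getLast_mem_getLast? h₁)
    (by rw [List.head?_reverse]; exact List.getLast_mem_getLast? h₀)
  have hya : y ≠ a := fun h => hyE (h ▸ haE)
  have hp₁ := (isPathList_append_cons.1 (hS ▸ hpath)).2.1
  have hp₂ : IsPathList G (S₀ ++ a :: S₁) :=
    ((isPathList_append_cons (b := b) (l₂ := S₂)).1 (by simpa [hS] using hpath)).1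
  have hp₃ : IsPathList G (b :: S₂) :=
    ((isPathList_append_cons (l₁ := S₀ ++ a :: S₁)).1 (by simpa [hS] using hpath)).2.1
  have hp₄ : IsPathList G (S₀ ++ [a]) := by
    rw [isPathList_append_cons] at hp₂ ⊢
    exact ⟨hp₂.1, isPathList_cons.2 ⟨isPathList_nil, by simp, startAdj_nil⟩,
      fun u hu hu' => hp₂.2.2.1 u hu (by simp_all), hp₂.2.2.2⟩
  rw [hS] at hnd hyP
  simp only [List.nodup_append, List.nodup_cons, List.mem_append, List.mem_cons] at hnd
  simp only [List.mem_append, List.mem_cons, hya, false_or] at hyP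
  -- The three vertices are chosen on the parts of `P` that `y` does not cut off from `a` or `b`.
  by_cases hy₀ : y ∈ S₀
  · have := hseg _ hp₁ (by simp; grind) a (by simp) haE
    exact hind (hI.sublist (m := [x, S₁.head h₁, S₂.head h₂]) (by simp)) (hDE hx)
      (this _ (by simp)) (this _ (by simp))
  by_cases hy₁ : y ∈ S₁
  · have hby : b ≠ y := by grind
    have h3 := hseg _ hp₃ (by simp; grind) b (by simp) (hbE hby)
    have h4 := hseg _ hp₄ (by simp; grind) a (by simp) haE
    exact hind (hI.sublist (m := [x, S₀.head h₀, S₂.head h₂]) (by simp)) (hDE hx)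
      (h4 _ (by simp)) (h3 _ (by simp))
  · have := hseg _ hp₂ (by simp; grind) a (by simp) haE
    exact hind (hJ.sublist (m := [x, S₁.getLast h₁, S₀.getLast h₀]) (by simp)) (hDE hx)
      (this _ (by simp)) (this _ (by simp))

/-- If a component off a longest path attaches to two vertices of that path, then the first of
them lies on every longest path. If `Q` avoids `a`, then the component `E` of `a` off `Q` is
attached exactly to a vertex `y` of `P` and to the only neighbour `x` of `a` in `D`. Now `P`
reaches `a` inside `E`, and `Q` reaches `x` inside `D`, so the two paths can exchange their
initial segments across the edge `a x`; the new paths have two vertices more in total. -/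
theorem IsCompOff.mem_of_two (hα : ∀ l, IsIndepList G l → l.length ≤ 4)
    (hG : G.Preconnected) (hP : IsLongest G P) (hS : P = S₀ ++ a :: (S₁ ++ b :: S₂))
    (hD : IsCompOff G P D) (ha : IsAttach G P D a) (hb : IsAttach G P D b)
    (hQ : IsLongest G Q) : a ∈ Q := by
  by_contra haQ
  obtain ⟨E, hE, haE⟩ := exists_isCompOff (G := G) haQ
  obtain ⟨y, hyP, hy⟩ := hE.exists_isAttach_mem hG hP hQ ha.1 haE
  obtain ⟨z, hz, hzy⟩ := hD.exists_ne_isAttach_of_two hα hG hP hS ha hb hQ hE haE hyP hy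
  have hclique := fun u hu v hv => hE.adj_of_two hα hQ hz hy hzy (u := u) (v := v) hu hv
  have hatt := fun v => hE.attach_eq_or_eq hα hQ hz hy hzy (c := v)
  obtain ⟨x, hx, hxa⟩ := ha.2
  have hxP := hD.notMem x hx
  have h₀ := ha.left_ne_nil hD hP hS
  have h₁ := hD.mid_ne_nil hP hS ha hb
  have h₂ := hb.right_ne_nil hD hP (A := S₀ ++ a :: S₁) (B := S₂) (by simp [hS])
  have hp := hP.1
  have hnd := hP.1.2
  rw [hS] at hnd
  simp only [List.nodup_append, List.nodup_cons, List.mem_append, List.mem_cons] at hnd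
  have hxE : x ∉ E := by
    intro hxE
    obtain ⟨c, S₁', rfl⟩ := List.exists_cons_of_ne_nil h₁
    obtain ⟨e, S₂', rfl⟩ := List.exists_cons_of_ne_nil h₂
    obtain ⟨s, S₀', hs⟩ := List.exists_cons_of_ne_nil (l := S₀.reverse) (by simpa using h₀)
    have hs₀ : S₀ = S₀'.reverse ++ [s] := by rw [← List.reverse_reverse S₀, hs]; simp
    subst hs₀
    have hS' : P = (S₀'.reverse ++ [s] ++ a :: c :: S₁') ++ b :: e :: S₂' := by simp [hS]
    have hxc := hD.not_adj_succ hP hS ha (c := c) (by simp) hx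
    have hxe := hD.not_adj_succ hP hS' hb (c := e) (by simp) hx
    have hxs := hD.reverse.not_adj_succ hP.reverse
      (A := (b :: e :: S₂').reverse ++ (c :: S₁').reverse)
      (a := a) (B := s :: S₀') (by simp [hS]) ha.reverse (c := s) (by simp) hx
    -- The two `P`-neighbours of `a` are not adjacent to `x`, so they are not in the clique `E`.
    have hnbr : ∀ v ∈ P, G.Adj a v → ¬ G.Adj x v → IsAttach G Q E v := by
      intro v hv hav hxv
      refine ⟨?_, a, haE, hav⟩
      by_contra hvQ
      exact hxv (hclique x hxE v (hE.closed a haE v hav hvQ) fun h => hxP (h ▸ hv))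
    have hadj : G.Adj a c ∧ G.Adj a s ∧ G.Adj b e := by
      rw [hS] at hp
      have h3 := hp.1
      simp only [List.append_assoc, List.cons_append, List.nil_append] at h3
      have h4 := (List.isChain_append.1 h3).2.1
      simp only [List.isChain_cons_cons] at h4
      have h5 := ((List.isChain_append (l₁ := c :: S₁')).1 h4.2.2).2.1
      simp only [List.isChain_cons_cons] at h5
      exact ⟨h4.2.1, h4.1.symm, h5.1⟩
    have hcatt := hnbr c (by simp [hS]) hadj.1 hxc
    have hsatt := hnbr s (by simp [hS]) hadj.2.1 hxs
    have hcs : c ≠ s := by grind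
    have hatt' := fun v => hE.attach_eq_or_eq hα hQ hcatt hsatt hcs (c := v)
    have hDE := hD.subset hE ha haE fun w hw hw' => hD.notMem w hw (by
      rcases hatt' w hw' with rfl | rfl <;> simp [hS])
    have hbE : b ∈ E := by
      obtain ⟨-, d, hd, hdb⟩ := hb
      refine hE.closed d (hDE hd) b hdb fun h => ?_
      have := hatt' b ⟨h, d, hDE hd, hdb⟩
      grind
    by_cases heQ : e ∈ Q
    · have := hatt' e ⟨heQ, b, hbE, hadj.2.2⟩
      grind
    · exact hxe (hclique x hxE e (hE.closed b hbE e hadj.2.2 heQ) (by rintro rfl; simp [hS] at hxP))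
  have hxQ : x ∈ Q := by
    by_contra h
    exact hxE (hE.closed a haE x hxa.symm h)
  have hxy : x ≠ y := fun h => hxP (h ▸ hyP)
  have hatt' := fun v => hE.attach_eq_or_eq hα hQ ⟨hxQ, a, haE, hxa.symm⟩ hy hxy (c := v)
  have hDatt := fun v => hD.attach_eq_or_eq hα hP ha hb (by grind) (c := v)
  have hyD : y ∉ D := fun h => hD.notMem y h hyP
  have hya : y ≠ a := fun h => haQ (h ▸ hy.1)
  -- If `b` were in `E` too, then `Q` could not leave `D`, but it goes from `x` to `y`.
  have hbE : b ∉ E := by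
    intro hbE
    refine hyD (hD.forall_mem hQ.1 (fun v hv hv' => hE.notMem v ?_ hv) hxQ hx y hy.1)
    rcases hDatt v hv' with rfl | rfl <;> assumption
  have hpa : IsPathList G (S₀ ++ [a]) :=
    ⟨(List.IsChain.prefix hp.1 ⟨S₁ ++ b :: S₂, by simp [hS]⟩),
      hp.2.sublist (List.IsPrefix.sublist ⟨S₁ ++ b :: S₂, by simp [hS]⟩)⟩
  have hpb : IsPathList G (a :: (S₁ ++ [b])) :=
    ⟨(List.IsChain.infix hp.1 ⟨S₀, S₂, by simp [hS]⟩),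
      hp.2.sublist (List.IsInfix.sublist ⟨S₀, S₂, by simp [hS]⟩)⟩
  have hpq : IsPathList G (a :: (S₁ ++ b :: S₂)) := (isPathList_append_cons.1 (hS ▸ hp)).2.1
  -- The part of `P` from `a` to `b` leaves `E`, which it can do only at `y`.
  have hy₁ : y ∈ S₁ ++ [b] := by
    by_contra hy₁
    refine hbE (hE.forall_mem hpb (fun v hv hv' => ?_) (a := a) (by simp) haE b (by simp))
    rcases hatt' v hv' with rfl | rfl
    · exact hxP (by simp [hS] at hv ⊢; grind)
    · simp_all
  have hS₀E : ∀ v ∈ S₀ ++ [a], v ∈ E := by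
    refine hE.forall_mem hpa (fun v hv hv' => ?_) (a := a) (by simp) haE
    rcases hatt' v hv' with rfl | rfl
    · exact hxP (by simp [hS] at hv ⊢; grind)
    · simp at hv hy₁
      grind
  -- `P` and `Q` exchange their initial segments: `S₀` and `a` lie in `E`, hence off `Q`, while `T₀`
  -- and `x` lie in `D`, hence off `P`.
  have key : ∀ {Q T₀ T₁ : List V}, IsLongest G Q → IsCompOff G Q E → a ∉ Q → Q = T₀ ++ x :: T₁ →
      y ∈ T₁ → False := by
    intro Q T₀ T₁ hQ hE haQ hT hyT
    have hq := hQ.1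
    rw [hT] at hq
    -- The part of `Q` from `x` to `y` leaves `D`, which it can do only at `b`.
    have hbT : b ∈ T₁ := by
      by_contra hbT
      refine hyD (hD.forall_mem (isPathList_append_cons.1 hq).2.1 (fun v hv hv' => ?_) (a := x)
        (by simp) hx y (by simp [hyT]))
      rcases hDatt v hv' with rfl | rfl
      · simp [hT] at haQ hv
        grind
      · rcases List.mem_cons.1 hv with rfl | hv
        · exact hxP hb.1
        · exact hbT hv
    have hT₀D : ∀ v ∈ T₀ ++ [x], v ∈ D := by
      refine hD.forall_mem ⟨(List.IsChain.prefix hq.1 ⟨T₁, by simp⟩),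
        hq.2.sublist (List.IsPrefix.sublist ⟨T₁, by simp⟩)⟩ (fun v hv hv' => ?_) (a := x)
        (by simp) hx
      have hvQ : v ∈ Q := by
        rw [hT]
        simp at hv ⊢
        grind
      rcases hDatt v hv' with rfl | rfl
      · exact haQ hvQ
      · rcases List.mem_append.1 hv with hv | hv
        · exact (isPathList_append_cons.1 hq).2.2.1 v hv (by simp [hbT])
        · exact hxP (List.mem_singleton.1 hv ▸ hb.1)
    have hlen₁ := hQ.2 (S₀ ++ a :: x :: T₁) (by
      rw [isPathList_append_cons] at hpa hq ⊢
      rw [hT] at haQ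
      refine ⟨hpa.1, isPathList_cons.2 ⟨hq.2.1, by grind, startAdj_cons.2 hxa.symm⟩, ?_, hpa.2.2.2⟩
      intro u hu hu'
      have huE := hS₀E u (by simp [hu])
      rcases List.mem_cons.1 hu' with rfl | hu'
      · exact hpa.2.2.1 u hu (by simp)
      · exact hE.notMem u huE (by rw [hT]; simp [hu']))
    have hlen₂ := hP.2 (T₀ ++ x :: a :: (S₁ ++ b :: S₂)) (by
      rw [isPathList_append_cons] at hq ⊢
      refine ⟨hq.1, isPathList_cons.2 ⟨hpq, fun h => hxP ?_, startAdj_cons.2 hxa⟩, ?_, hq.2.2.2⟩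
      · rw [hS]
        exact List.mem_append_right _ h
      intro u hu hu'
      have huD := hT₀D u (by simp [hu])
      rcases List.mem_cons.1 hu' with rfl | hu'
      · exact hq.2.2.1 u hu (by simp)
      · exact hD.notMem u huD (by rw [hS]; exact List.mem_append_right _ hu'))
    simp [hT] at hlen₁
    simp [hS] at hlen₂
    omega
  obtain ⟨T₀, T₁, hT⟩ := List.append_of_mem hxQ
  have hyT := hy.1
  simp only [hT, List.mem_append, List.mem_cons, hxy.symm, false_or] at hyT
  rcases hyT with hyT | hyT
  · exact key hQ.reverse hE.reverse (by simpa using haQ) (T₀ := T₁.reverse) (T₁ := T₀.reverse)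
      (by simp [hT]) (by simpa using hyT)
  · exact key hQ hE haQ hT hyT

/-- If `Q` avoids the attachment vertex `a` of `P`, and `y` is the only attachment vertex of the
component `E` of `a` off `Q`, then `y` is next to `a` on `P`. Otherwise `E` contains `D`, an end
of `P` and a neighbour of `a` on `P`, which gives three independent vertices in `E`. -/
theorem IsCompOff.eq_neighbor_of_unique (hα : ∀ l, IsIndepList G l → l.length ≤ 4)
    (hG : G.Preconnected) {A B : List V} (hP : IsLongest G P) (hS : P = A ++ a :: B)
    (hD : IsCompOff G P D) (ha : IsAttach G P D a) (hQ : IsLongest G Q) (hE : IsCompOff G Q E)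
    (haE : a ∈ E) (huniq : ∀ z, IsAttach G Q E z → z = y) : y ∈ B.head? ∨ y ∈ A.getLast? := by
  obtain ⟨y', hyP, hy⟩ := hE.exists_isAttach_mem hG hP hQ ha.1 haE
  obtain rfl := huniq y' hy
  have key : ∀ {P A B : List V}, IsLongest G P → P = A ++ a :: B → IsCompOff G P D →
      IsAttach G P D a → y' ∈ P → y' ∈ B → y' ∈ B.head? := by
    intro P A B hP hS hD ha hyP hyB
    obtain ⟨s, A, rfl⟩ := List.exists_cons_of_ne_nil (ha.left_ne_nil hD hP hS)
    obtain ⟨c, B, rfl⟩ := List.exists_cons_of_ne_nil (ha.right_ne_nil hD hP hS)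
    by_contra hyc
    have hp := hP.1
    have hnd := hP.1.2
    rw [hS] at hnd
    simp only [List.nodup_append, List.nodup_cons, List.mem_cons] at hnd
    obtain ⟨x, hx⟩ := hD.nonempty
    have hDE := hD.subset hE ha haE fun z hz hz' => hD.notMem z hz (huniq z hz' ▸ hyP)
    have hmem := hE.forall_mem (m := s :: A ++ [a, c])
      ⟨(List.IsChain.prefix hp.1 ⟨B, by simp [hS]⟩),
        hp.2.sublist (List.IsPrefix.sublist ⟨B, by simp [hS]⟩)⟩ (fun v hv hv' => by
          obtain rfl := huniq v hv'
          simp at hv hyc hyB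
          grind) (a := a) (by simp) haE
    have := hE.length_le_two hα hG hQ (hD.indep_one hP hS ha (x := x) hx (s := s) (c := c)
      (by simp) (by simp)) (by
        simp only [List.forall_mem_cons]
        exact ⟨hDE hx, hmem s (by simp), hmem c (by simp), by simp⟩)
    simp at this
  have hyP' := hyP
  rw [hS] at hyP'
  rcases List.mem_append.1 hyP' with h | h
  · right
    have := key hP.reverse (A := B.reverse) (B := A.reverse) (by simp [hS]) hD.reverse ha.reverse
      (by simpa using hyP) (by simpa using h)
    simpa using this
  · left
    refine key hP hS hD ha hyP ?_
    rcases List.mem_cons.1 h with rfl | h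
    · exact absurd hy.1 (hE.notMem _ haE)
    · exact h

/-- If all components off longest paths have a single attachment vertex, consider an attachment
vertex `a` of `P`, a path `Q` that avoids `a` and the corresponding neighbour `y` of `a` on `P`. A
path `R` that avoids `y` would avoid `a` as well, and its attachment vertex would be the other
neighbour of `a` on `P`, which is not on `Q`. -/
theorem exists_forall_mem_of_isLongest [Nonempty V]
    (hα : ∀ l, IsIndepList G l → l.length ≤ 4) (hG : G.Preconnected) :
    ∃ v, ∀ Q, IsLongest G Q → v ∈ Q := by
  by_contra! hno
  have hsingle : ∀ {P : List V} {D : Set V} {a b : V}, IsLongest G P → IsCompOff G P D →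
      IsAttach G P D a → IsAttach G P D b → b = a := by
    intro P D a b hP hD ha hb
    by_contra hab
    obtain ⟨A, B, C, hS | hS⟩ := exists_split_of_ne hab hb.1 ha.1
    · obtain ⟨Q, hQ, h⟩ := hno b
      exact h (hD.mem_of_two hα hG hP hS hb ha hQ)
    · obtain ⟨Q, hQ, h⟩ := hno a
      exact h (hD.mem_of_two hα hG hP hS ha hb hQ)
  obtain ⟨P, hP, hv⟩ := hno (Classical.arbitrary V)
  obtain ⟨D, hD, -⟩ := exists_isCompOff (G := G) hv
  obtain ⟨a, ha⟩ := hD.exists_isAttach hG hP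
  obtain ⟨Q, hQ, haQ⟩ := hno a
  obtain ⟨E, hE, haE⟩ := exists_isCompOff (G := G) haQ
  obtain ⟨y, hyP, hy⟩ := hE.exists_isAttach_mem hG hP hQ ha.1 haE
  obtain ⟨R, hR, hyR⟩ := hno y
  obtain ⟨F, hF, hyF⟩ := exists_isCompOff (G := G) hyR
  obtain ⟨w, hwQ, hw⟩ := hF.exists_isAttach_mem hG hQ hR hy.1 hyF
  have hEF := hE.subset hF hy hyF fun z hz hz' => hE.notMem z hz (hsingle hR hF hw hz' ▸ hwQ)
  have key : ∀ {P A B : List V}, IsLongest G P → P = A ++ a :: B → IsCompOff G P D →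
      IsAttach G P D a → y ∈ B.head? → False := by
    intro P A B hP hS hD ha hyB
    have hp := hP.1
    rcases hD.eq_neighbor_of_unique hα hG hP hS ha hR hF (hEF haE)
      (fun z hz => hsingle hR hF hw hz) with h | h
    · obtain rfl : w = y := Option.mem_unique h hyB
      exact hyR hw.1
    · refine hE.notMem w ?_ hwQ
      refine hE.forall_mem (m := A ++ [a]) ⟨(List.IsChain.prefix hp.1 ⟨B, by simp [hS]⟩),
        hp.2.sublist (List.IsPrefix.sublist ⟨B, by simp [hS]⟩)⟩ (fun v hv hv' => ?_) (a := a)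
        (by simp) haE w (by simp [List.mem_of_mem_getLast? h])
      obtain rfl := hsingle hQ hE hy hv'
      have hnd := hp.2
      have := List.mem_of_mem_head? hyB
      rw [hS] at hnd
      simp only [List.nodup_append, List.nodup_cons, List.mem_cons] at hnd
      simp at hv
      grind
  obtain ⟨A, B, hS⟩ := List.append_of_mem ha.1
  rcases hD.eq_neighbor_of_unique hα hG hP hS ha hQ hE haE
    (fun z hz => hsingle hQ hE hy hz) with h | h
  · exact key hP hS hD ha h
  · exact key hP.reverse (A := B.reverse) (B := A.reverse) (by simp [hS]) hD.reverse ha.reverse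
      (by simpa using h)

end Transversal

/-! ### Longest paths as walks, the Gallai number and forbidden subgraphs -/

section Walks

theorem IsLongestPath.isLongest_support {u v : V} {p : G.Walk u v} (hp : IsLongestPath G p) :
    IsLongest G p.support := by
  refine ⟨⟨p.isChain_adj_support, hp.1.support_nodup⟩, fun l hl => ?_⟩
  rcases eq_or_ne l [] with rfl | hne
  · simp
  · have := hp.2 _ _ (SimpleGraph.Walk.ofSupport l hne hl.1) (by
      rw [SimpleGraph.Walk.isPath_def, SimpleGraph.Walk.support_ofSupport]
      exact hl.2)
    rw [SimpleGraph.Walk.length_ofSupport] at this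
    rw [SimpleGraph.Walk.length_support]
    omega

theorem exists_isLongestPath [Finite V] [Nonempty V] (G : SimpleGraph V) :
    ∃ (u v : V) (p : G.Walk u v), IsLongestPath G p := by
  have := Fintype.ofFinite V
  let S : Set ℕ := {n | ∃ (u v : V) (p : G.Walk u v), p.IsPath ∧ p.length = n}
  have hne : S.Nonempty := ⟨0, Classical.arbitrary V, _, .nil, by simp, rfl⟩
  have hbdd : BddAbove S := ⟨Fintype.card V, by
    rintro n ⟨u, v, p, hp, rfl⟩
    exact hp.length_lt.le⟩
  obtain ⟨u, v, p, hp, hlen⟩ := Nat.sSup_mem hne hbdd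
  exact ⟨u, v, p, hp, fun c d q hq => hlen ▸ le_csSup hbdd ⟨c, d, q, hq, rfl⟩⟩

theorem IsIndepList.length_le_indepNum [Finite V] {l : List V} (hl : IsIndepList G l) :
    l.length ≤ G.indepNum := by
  classical
  have hnd : l.Nodup := hl.imp fun h => h.1
  rw [← List.toFinset_card_of_nodup hnd]
  apply SimpleGraph.IsIndepSet.card_le_indepNum
  rw [List.coe_toFinset]
  have : Std.Symm fun u v => ¬ G.Adj u v := ⟨fun u v h h' => h h'.symm⟩
  exact fun u hu v hv huv => List.Pairwise.forall (hl.imp fun h => h.2) hu hv huv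

theorem exists_isGallaiVertex [Finite V] (hG : G.Connected) (hα : G.indepNum ≤ 4) :
    ∃ v, IsGallaiVertex G v := by
  have := hG.nonempty
  obtain ⟨v, hv⟩ := exists_forall_mem_of_isLongest
    (fun l (hl : IsIndepList G l) => hl.length_le_indepNum.trans hα) hG.preconnected
  exact ⟨v, fun a b p hp => ⟨v, rfl, hv _ hp.isLongest_support⟩⟩

theorem lpt_eq_one [Finite V] [Nonempty V] {v : V} (hv : IsGallaiVertex G v) : lpt G = 1 := by
  have hmem : 1 ∈ {n : ℕ | ∃ S : Finset V, S.card = n ∧ IsGallaiSet G (S : Set V)} :=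
    ⟨{v}, by simp, by simpa [IsGallaiVertex] using hv⟩
  refine le_antisymm (Nat.sInf_le hmem) (Nat.one_le_iff_ne_zero.2 fun h0 => ?_)
  have h := Nat.sInf_mem ⟨1, hmem⟩
  rw [show sInf _ = 0 from h0] at h
  obtain ⟨S, hS, hGal⟩ := h
  obtain ⟨a, b, p, hp⟩ := exists_isLongestPath G
  obtain ⟨w, hw, -⟩ := hGal a b p hp
  simp [Finset.card_eq_zero.1 hS] at hw

theorem indepNum_lt_of_free [Finite V] {k : ℕ}
    (h : Free (copies k (SimpleGraph.pathGraph 1)) V G) : G.indepNum < k := by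
  by_contra! hk
  obtain ⟨s, hs⟩ := G.exists_isNIndepSet_indepNum
  obtain ⟨t, hts, ht⟩ := Finset.exists_subset_card_eq (hk.trans hs.card_eq.ge)
  have e := (t.equivFinOfCardEq ht).symm
  refine h ⟨⟨⟨fun x => e x.1, fun x y hxy => ?_⟩, fun {x y} => ?_⟩⟩
  · exact Prod.ext (e.injective (Subtype.ext hxy)) (Subsingleton.elim _ _)
  · have h1 : ¬ (copies k (SimpleGraph.pathGraph 1)).Adj x y := fun hxy =>
      hxy.2.ne (Subsingleton.elim _ _)
    have h2 : ¬ G.Adj (e x.1) (e y.1) := fun hxy =>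
      hs.isIndepSet (hts (e x.1).2) (hts (e y.1).2) hxy.ne hxy
    exact iff_of_false h2 h1

end Walks

end GallaiPaths

theorem mainTheorem2 :
    (∀ (V : Type u) [Finite V] (G : SimpleGraph V), G.Connected → G.indepNum ≤ 4 →
      ∃ v : V, GallaiPaths.IsGallaiVertex G v) ∧
    GallaiPaths.IsGallaiFamily.{u}
      (GallaiPaths.Free.{u} (GallaiPaths.copies 5 (SimpleGraph.pathGraph 1))) := by
  refine ⟨fun V _ G hG hα => GallaiPaths.exists_isGallaiVertex hG hα, fun V _ G hfree hG => ?_⟩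
  have := hG.nonempty
  obtain ⟨v, hv⟩ := GallaiPaths.exists_isGallaiVertex hG
    (Nat.le_of_lt_succ (GallaiPaths.indepNum_lt_of_free hfree))
  exact GallaiPaths.lpt_eq_one hv
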